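/- Let $\mathcal G=(V,E)$ be a finite directed acyclic graph. A weight matrix supported on $\mathcal G$ is identified with its vector of edge weights $C=(c_e)_{e\in E}\in\mathbb R^E$. A directed path $\pi$ from $i$ to $j$ has weight $\omega_C(\pi)=\sum_{e\in\pi}c_e$, and it is *critical* if its weight is maximal among all directed paths from $i$ to $j$. The matrix $C$ is *generic* if for all $i,j\in V$ that are joined by a directed path from $i$ to $j$ there is exactly one critical path from $i$ to $j$. For $L\subseteq V$ the *critical DAG* $\mathcal G^*_{C,L}$ has an edge $i\to j$ (for $i\ne j$) whenever there is a directed path from $i$ to $j$ in $\mathcal G$ and no critical path from $i$ to $j$ has an interior node in $L$. Distinct nodes $i,j\notin L$ are *$C^*$-connected given $L$* if $\mathcal G^*_{C,L}$ contains a path between them, with distinct nodes, of one of the forms $$ i\to j,\qquad i\leftarrow p\to j,\qquad i\to \ell\leftarrow j,\qquad i\leftarrow p\to\ell\leftarrow j,\qquad i\leftarrow p\to\ell\leftarrow q\to j $$ (or the form obtained by exchanging $i$ and $j$), where $\ell\in L$ and $p,q\notin L$. The *maxoid* $\mathcal M(C)$ of $(\mathcal G,C)$ is the set of all conditional independence statements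 $[I\perp J\mid L]$, with $I,J,L\subseteq V$ pairwise disjoint, such that no $i\in I$ and $j\in J$ are $C^*$-connected given $L$. A maxoid $\mathcal M(C)$ with $C$ generic is called a *generic maxoid* of $\mathcal G$; for such a maxoid $M$ put $\mathrm{cone}(M)=\{C\in\mathbb R^E : C \text{ is generic and } \mathcal M(C)=M\}$. A *polyhedral cone* is a finite intersection of closed linear half-spaces (possibly the whole space). A *face* of a cone $K$ is a set $K\cap\{u=0\}$, where $u$ is a linear functional that is nonnegative on $K$ ($u=0$ is allowed, so $K$ is a face of itself). A *polyhedral fan* is a finite collection of nonempty polyhedral cones that contains all faces of its members and in which the intersection of any two members is a face of both; it is *complete* if its members cover the space. **Theorem.** 1. The non-generic matrices are contained in a finite union of linear hyperplanes of $\mathbb R^E$. For every generic maxoid $M$ of $\mathcal G$, $\mathrm{cone}(M)$ is a full-dimensional open polyhedral cone, i.e. a finite intersection of open linear half-spaces whose linear span is $\mathbb R^E$. 2. Let $\mathcal F_{\mathcal G}$ be the collection of the closures $\overline{\mathrm{cone}(M)}$, over the generic maxoids $M$ of $\mathcal G$, together with all faces of these closures. Then $\mathcal F_{\mathcal G}$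 is a complete polyhedral fan in $\mathbb R^E$. 3. The map $M\mapsto\overline{\mathrm{cone}(M)}$ is a bijection from the set of generic maxoids of $\mathcal G$ onto the set of inclusion-maximal cones of $\mathcal F_{\mathcal G}$. 4. For every $F\in\mathcal F_{\mathcal G}$ the relative interior of $F$ is nonempty and $\mathcal M(C)$ is the same for all $C$ in it; call it $\Phi(F)$. Then $\Phi(\overline{\mathrm{cone}(M)})=M$ for every generic maxoid $M$, and $\Phi$ is a surjection from $\mathcal F_{\mathcal G}$ onto the set $\{\mathcal M(C): C\in\mathbb R^E\}$ of all maxoids of $\mathcal G$. It is inclusion-reversing: for $F_1,F_2\in\mathcal F_{\mathcal G}$, if $F_1$ is a face of $F_2$, then $\Phi(F_1)\supseteq\Phi(F_2)$. -/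

import Mathlib

namespace Maxoid

section Fans

variable {W : Type*} [AddCommGroup W] [Module ℝ W]

/-- A (closed) polyhedral cone: a finite intersection of closed linear half-spaces. The empty
intersection, i.e. the whole space, is allowed. -/
def IsPolyhedralCone (K : Set W) : Prop :=
  ∃ U : Set (W →ₗ[ℝ] ℝ), U.Finite ∧ K = {x | ∀ u ∈ U, 0 ≤ u x}

/-- An open polyhedral cone: a finite intersection of open linear half-spaces. -/
def IsOpenPolyhedralCone (K : Set W) : Prop :=
  ∃ U : Set (W →ₗ[ℝ] ℝ), U.Finite ∧ K = {x | ∀ u ∈ U, 0 < u x}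

/-- A cone is full-dimensional if the smallest linear subspace containing it is the whole space. -/
def IsFullDimensional (K : Set W) : Prop :=
  Submodule.span ℝ K = ⊤

/-- `F` is a face of `K`: the intersection of `K` with the zero set of a linear functional which is
nonnegative on `K`. The zero functional is allowed, so `K` is a face of itself. -/
def IsFace (F K : Set W) : Prop :=
  ∃ u : W →ₗ[ℝ] ℝ, (∀ x ∈ K, 0 ≤ u x) ∧ F = {x ∈ K | u x = 0}

/-- A polyhedral fan: a finite collection of nonempty polyhedral cones which is closed under taking
nonempty faces and in which the intersection of any two cones is a face of both. -/
structure IsPolyhedralFan (𝓕 : Set (Set W)) : Prop where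
  finite : 𝓕.Finite
  nonempty : ∀ K ∈ 𝓕, K.Nonempty
  polyhedral : ∀ K ∈ 𝓕, IsPolyhedralCone K
  face_mem : ∀ K ∈ 𝓕, ∀ F, IsFace F K → F.Nonempty → F ∈ 𝓕
  inter_face : ∀ K₁ ∈ 𝓕, ∀ K₂ ∈ 𝓕, IsFace (K₁ ∩ K₂) K₁ ∧ IsFace (K₁ ∩ K₂) K₂

/-- A fan is complete if its cones cover the whole space. -/
def IsComplete (𝓕 : Set (Set W)) : Prop :=
  ⋃₀ 𝓕 = Set.univ

end Fans

section Graphs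

variable {V : Type*}

/-- A digraph is acyclic (a DAG) if it has no directed cycle; loops count as cycles. -/
def IsDAG (G : Digraph V) : Prop :=
  ∀ v, ¬ Relation.TransGen G.Adj v v

/-- The set `E` of edges of `G`. -/
abbrev Edge (G : Digraph V) : Type _ :=
  {e : V × V // G.Adj e.1 e.2}

/-- The space `ℝ^E` of weight matrices supported on `G`; only the finite entries are recorded. -/
abbrev Weight (G : Digraph V) : Type _ :=
  Edge G → ℝ

/-- Directed paths of `G` from one node to another (in a DAG nodes cannot be repeated). -/
inductive DiPath (G : Digraph V) : V → V → Type _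
  | nil (v : V) : DiPath G v v
  | cons {u v w : V} (h : G.Adj u v) (p : DiPath G v w) : DiPath G u w

/-- The nodes of a directed path, endpoints included. -/
def DiPath.nodes {G : Digraph V} : {i j : V} → DiPath G i j → Set V
  | _, _, .nil v => {v}
  | _, _, .cons (u := u) _ p => insert u p.nodes

/-- The weight of a directed path: the sum of the weights of its edges. -/
def DiPath.weight {G : Digraph V} (C : Weight G) : {i j : V} → DiPath G i j → ℝ
  | _, _, .nil _ => 0
  | _, _, .cons (u := u) (v := v) h p => C ⟨(u, v), h⟩ + p.weight C

/-- A path is critical if its weight is maximal among all directed paths with the same ends. -/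
def IsCritical {G : Digraph V} (C : Weight G) {i j : V} (p : DiPath G i j) : Prop :=
  ∀ q : DiPath G i j, q.weight C ≤ p.weight C

/-- `C` is generic if any two nodes joined by a directed path have a unique critical path. -/
def IsGeneric (G : Digraph V) (C : Weight G) : Prop :=
  ∀ i j : V, Nonempty (DiPath G i j) → ∃! p : DiPath G i j, IsCritical C p

/-- The edges of the critical DAG given `L`: `i → j` is an edge if `i ≠ j`, there is a directed path
from `i` to `j`, and no critical path from `i` to `j` has an interior node in `L`. -/
def CritAdj (G : Digraph V) (C : Weight G) (L : Set V) (i j : V) : Prop :=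
  i ≠ j ∧ Nonempty (DiPath G i j) ∧
    ∀ p : DiPath G i j, IsCritical C p → ∀ k ∈ p.nodes, k ≠ i → k ≠ j → k ∉ L

/-- Nodes `i` and `j` are `C*`-connected given `L` if the critical DAG given `L` contains a path
between them of one of five types. Colliders lie in `L`, interior non-colliders do not.
Types (a) and (d) are not symmetric in `i` and `j` and are listed in both orientations. -/
def CStarConnected (G : Digraph V) (C : Weight G) (L : Set V) (i j : V) : Prop :=
  -- (a) `i → j` or `i ← j`
  (CritAdj G C L i j ∨ CritAdj G C L j i) ∨
  -- (b) `i ← p → j`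
  (∃ p, p ∉ L ∧ CritAdj G C L p i ∧ CritAdj G C L p j) ∨
  -- (c) `i → l ← j`
  (∃ l, l ∈ L ∧ CritAdj G C L i l ∧ CritAdj G C L j l) ∨
  -- (d) `i ← p → l ← j` or `i → l ← p → j`
  (∃ p l, p ∉ L ∧ l ∈ L ∧ p ≠ j ∧ CritAdj G C L p i ∧ CritAdj G C L p l ∧ CritAdj G C L j l) ∨
  (∃ p l, p ∉ L ∧ l ∈ L ∧ p ≠ i ∧ CritAdj G C L i l ∧ CritAdj G C L p l ∧ CritAdj G C L p j) ∨
  -- (e) `i ← p → l ← q → j`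
  (∃ p l q, p ∉ L ∧ l ∈ L ∧ q ∉ L ∧ p ≠ q ∧ p ≠ j ∧ q ≠ i ∧
    CritAdj G C L p i ∧ CritAdj G C L p l ∧ CritAdj G C L q l ∧ CritAdj G C L q j)

/-- A conditional independence statement `[I ⫫ J | L]` over the ground set `V`. -/
@[ext]
structure CIStatement (V : Type*) where
  /-- the first set `I` -/
  left : Set V
  /-- the second set `J` -/
  right : Set V
  /-- the conditioning set `L` -/
  given : Set V
  left_right : Disjoint left right
  left_given : Disjoint left given
  right_given : Disjoint right given

/-- The maxoid of the weighted DAG `(G, C)`: all `[I ⫫ J | L]` such that no node of `I` is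
`C*`-connected to a node of `J` given `L`. -/
def maxoid (G : Digraph V) (C : Weight G) : Set (CIStatement V) :=
  {s | ∀ i ∈ s.left, ∀ j ∈ s.right, ¬ CStarConnected G C s.given i j}

/-- The generic maxoids of `G`. -/
def genericMaxoids (G : Digraph V) : Set (Set (CIStatement V)) :=
  maxoid G '' {C | IsGeneric G C}

/-- The set of all generic weight matrices whose maxoid is `M`. -/
def openCone (G : Digraph V) (M : Set (CIStatement V)) : Set (Weight G) :=
  {C | IsGeneric G C ∧ maxoid G C = M}

/-- The maxoid fan: the closures of the open cones of the generic maxoids, with all their faces. -/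
def maxoidFan (G : Digraph V) : Set (Set (Weight G)) :=
  {F | ∃ M ∈ genericMaxoids G, IsFace F (closure (openCone G M))}

/-- The maximal cones (with respect to inclusion) of the maxoid fan. -/
def maximalCones (G : Digraph V) : Set (Set (Weight G)) :=
  {F | Maximal (· ∈ maxoidFan G) F}

/-- The map `Φ`: the maxoid of a cone, read off from the points in its relative interior. -/
def coneMaxoid (G : Digraph V) (F : Set (Weight G)) : Set (CIStatement V) :=
  {s | ∃ C ∈ intrinsicInterior ℝ F, s ∈ maxoid G C}

end Graphs

end Maxoid

/-! The maxoid fan is a normal fan. Every directed path gives a linear functional on `Weight G`, and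
paths are grouped into classes by their ends. The set of functionals maximal in their class at `C`
is the set of critical paths of `C`. The closed cone of `C` consists of all weights at which these
paths remain critical. For any finite family of functionals in classes, such cones form a complete
fan, because the maximal set of a sum of two points of one cone is the intersection of their maximal
sets (`argmaxSet_add`). This identity yields the faces, the intersections, the closures and the
relative interiors.

It remains to compare maxoids with sets of critical paths. More critical paths mean fewer edges in
the critical DAGs, hence more independence statements, so the maxoid is monotone in the critical set
(`maxoid_subset_of_criticalSet_subset`). For generic weights it also determines the critical set:
`reflTransGen_of_maxoid_subset` uses one well-chosen conditioning set to compare the first steps of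
two critical paths, and acyclicity forces these steps to agree. Thus the generic cones are exactly
the open cells of the normal fan. -/

namespace Maxoid

/-! ### Normal fans of finite families of linear functionals -/

section ArgmaxFan

variable {W J I : Type*} [NormedAddCommGroup W] [NormedSpace ℝ W]

/-- The members of a family of linear functionals that are maximal at `x` within their class. -/
def argmaxSet (κ : J → I) (ω : J → W →ₗ[ℝ] ℝ) (x : W) : Set J :=
  {p | ∀ q, κ q = κ p → ω q x ≤ ω p x}

/-- The closed normal cone at `x` of a family of linear functionals divided into classes. -/
def argmaxCone (κ : J → I) (ω : J → W →ₗ[ℝ] ℝ) (x : W) : Set W :=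
  {y | argmaxSet κ ω x ⊆ argmaxSet κ ω y}

variable {κ : J → I} {ω : J → W →ₗ[ℝ] ℝ}

lemma mem_argmaxSet {x : W} {p : J} :
    p ∈ argmaxSet κ ω x ↔ ∀ q, κ q = κ p → ω q x ≤ ω p x := Iff.rfl

lemma mem_argmaxCone {x y : W} : y ∈ argmaxCone κ ω x ↔ argmaxSet κ ω x ⊆ argmaxSet κ ω y :=
  Iff.rfl

lemma mem_argmaxCone_self (x : W) : x ∈ argmaxCone κ ω x := fun _ h => h

lemma argmaxCone_subset {x y : W} (h : y ∈ argmaxCone κ ω x) :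
    argmaxCone κ ω y ⊆ argmaxCone κ ω x := fun _ hz => Set.Subset.trans h hz

lemma exists_mem_argmaxSet [Finite J] (κ : J → I) (ω : J → W →ₗ[ℝ] ℝ) (x : W) (p : J) :
    ∃ q ∈ argmaxSet κ ω x, κ q = κ p := by
  obtain ⟨q, hq, hmax⟩ := Set.exists_max_image {q | κ q = κ p} (fun q => ω q x)
    (Set.toFinite _) ⟨p, rfl⟩
  exact ⟨q, fun r hr => hmax r (hr.trans hq), hq⟩

lemma argmaxSet_eq_of_mem {x : W} {p q : J} (hp : p ∈ argmaxSet κ ω x)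
    (hq : q ∈ argmaxSet κ ω x) (h : κ q = κ p) : ω q x = ω p x :=
  le_antisymm (hp q h) (hq p h.symm)

lemma mem_argmaxSet_of_eq {x : W} {p q : J} (hp : p ∈ argmaxSet κ ω x) (h : κ q = κ p)
    (hv : ω q x = ω p x) : q ∈ argmaxSet κ ω x := fun r hr =>
  (hp r (hr.trans h)).trans hv.ge

lemma argmaxSet_zero : argmaxSet κ ω (0 : W) = Set.univ := by
  ext p; simp [mem_argmaxSet]

lemma zero_mem_argmaxCone (x : W) : (0 : W) ∈ argmaxCone κ ω x := by
  rw [mem_argmaxCone, argmaxSet_zero]; exact Set.subset_univ _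

lemma argmaxSet_smul {t : ℝ} (ht : 0 < t) (x : W) : argmaxSet κ ω (t • x) = argmaxSet κ ω x := by
  ext p; simp [mem_argmaxSet, ht]

/-- A functional maximal at `x` attains the class maximum at `y` and at `z` simultaneously, so the
class maximum at `y + z` is the sum of the two maxima. It is attained only where both are. -/
lemma argmaxSet_add [Finite J] {x y z : W} (hy : y ∈ argmaxCone κ ω x)
    (hz : z ∈ argmaxCone κ ω x) :
    argmaxSet κ ω (y + z) = argmaxSet κ ω y ∩ argmaxSet κ ω z := by
  ext p
  constructor
  · intro hp
    obtain ⟨q, hq, hqp⟩ := exists_mem_argmaxSet κ ω x p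
    have h1 := hy hq p hqp.symm
    have h2 := hz hq p hqp.symm
    have h3 := hp q hqp
    simp only [map_add] at h3
    exact ⟨mem_argmaxSet_of_eq (hy hq) hqp.symm (by linarith),
      mem_argmaxSet_of_eq (hz hq) hqp.symm (by linarith)⟩
  · rintro ⟨h1, h2⟩ q hq
    simpa using add_le_add (h1 q hq) (h2 q hq)

lemma convex_argmaxCone (x : W) : Convex ℝ (argmaxCone κ ω x) := by
  intro y hy z hz a b ha hb _ p hp q hq
  simpa using add_le_add (mul_le_mul_of_nonneg_left (hy hp q hq) ha)
    (mul_le_mul_of_nonneg_left (hz hp q hq) hb)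

lemma isPolyhedralCone_argmaxCone [Finite J] (x : W) :
    IsPolyhedralCone (argmaxCone κ ω x) := by
  refine ⟨(fun a : J × J => ω a.1 - ω a.2) '' {a | a.1 ∈ argmaxSet κ ω x ∧ κ a.2 = κ a.1},
    Set.toFinite _, ?_⟩
  ext y
  simp only [Set.mem_ofPred_eq, Set.forall_mem_image, Prod.forall, LinearMap.sub_apply, sub_nonneg]
  exact ⟨fun h p q hpq => h hpq.1 q hpq.2, fun h p hp q hq => h p q ⟨hp, hq⟩⟩

/-- A normal cone inside another one is a face of it. -/
lemma isFace_argmaxCone [Finite J] {x y : W} (h : y ∈ argmaxCone κ ω x) :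
    IsFace (argmaxCone κ ω y) (argmaxCone κ ω x) := by
  have hfin : {a : J × J | a.1 ∈ argmaxSet κ ω x ∧ a.2 ∈ argmaxSet κ ω y ∧
    κ a.2 = κ a.1}.Finite := Set.toFinite _
  have hval (z : W) : (∑ a ∈ hfin.toFinset, (ω a.1 - ω a.2)) z =
      ∑ a ∈ hfin.toFinset, (ω a.1 z - ω a.2 z) := by
    simp [LinearMap.sum_apply]
  have hnn {z : W} (hz : z ∈ argmaxCone κ ω x) : ∀ a ∈ hfin.toFinset, 0 ≤ ω a.1 z - ω a.2 z := by
    intro a ha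
    rw [hfin.mem_toFinset] at ha
    exact sub_nonneg.2 (hz ha.1 _ ha.2.2)
  -- Each summand is nonnegative on the larger cone, and all of them vanish exactly when every
  -- functional maximal at `y` stays maximal.
  refine ⟨∑ a ∈ hfin.toFinset, (ω a.1 - ω a.2), fun z hz => ?_, ?_⟩
  · rw [hval]; exact Finset.sum_nonneg (hnn hz)
  · ext z
    simp only [Set.mem_ofPred_eq, hval]
    constructor
    · intro hz
      refine ⟨argmaxCone_subset h hz, Finset.sum_eq_zero fun a ha => ?_⟩
      rw [hfin.mem_toFinset] at ha
      exact sub_eq_zero.2 (argmaxSet_eq_of_mem (hz ha.2.1) (hz (h ha.1)) ha.2.2.symm)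
    · rintro ⟨hz, h0⟩ q hq
      rw [Finset.sum_eq_zero_iff_of_nonneg (hnn hz)] at h0
      obtain ⟨p, hp, hpq⟩ := exists_mem_argmaxSet κ ω x q
      have := h0 (p, q) (hfin.mem_toFinset.2 ⟨hp, hq, hpq.symm⟩)
      exact mem_argmaxSet_of_eq (hz hp) hpq.symm (sub_eq_zero.1 this).symm

/-- A nonempty part of a normal cone that is closed under addition lies in the normal cone of one
of its points. -/
lemma exists_subset_argmaxCone [Finite J] {x : W} {T : Set W} (hT : T ⊆ argmaxCone κ ω x)
    (hne : T.Nonempty) (hadd : ∀ y ∈ T, ∀ z ∈ T, y + z ∈ T) :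
    ∃ y ∈ T, T ⊆ argmaxCone κ ω y := by
  -- If the maximal set at `y` is minimal, adding any `z` in `T` cannot shrink it, so it lies in the
  -- maximal set at `z`.
  obtain ⟨_, ⟨y, hy, rfl⟩, hmin⟩ := (Set.toFinite (argmaxSet κ ω '' T)).exists_minimal
    (hne.image _)
  refine ⟨y, hy, fun z hz => ?_⟩
  have h := argmaxSet_add (hT hy) (hT hz)
  have := hmin (Set.mem_image_of_mem _ (hadd y hy z hz)) (h.trans_subset Set.inter_subset_left)
  exact this.trans (h.trans_subset Set.inter_subset_right)

open Filter Topology in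
/-- For small `t > 0` the maximal functionals at `x + t • z` are maximal at `x`. -/
lemma eventually_argmaxSet_subset [Finite J] (x z : W) :
    ∀ᶠ t : ℝ in 𝓝 0, argmaxSet κ ω (x + t • z) ⊆ argmaxSet κ ω x := by
  have key : ∀ p : J, ∀ᶠ t : ℝ in 𝓝 0, p ∈ argmaxSet κ ω (x + t • z) → p ∈ argmaxSet κ ω x := by
    intro p
    by_cases hp : p ∈ argmaxSet κ ω x
    · exact Eventually.of_forall fun _ _ => hp
    · simp only [mem_argmaxSet, not_forall, not_le] at hp
      obtain ⟨q, hq, hlt⟩ := hp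
      have hc : Continuous fun t : ℝ => ω q (x + t • z) - ω p (x + t • z) := by
        simp only [map_add, map_smul, smul_eq_mul]; fun_prop
      have := (hc.tendsto 0).eventually (lt_mem_nhds (a := 0) (by simpa using hlt))
      filter_upwards [this] with t ht h
      have := h q hq
      linarith
  filter_upwards [eventually_all.2 key] with t ht p using ht p

open Filter Topology in
/-- Every face of a normal cone is the normal cone of one of its points. -/
lemma IsFace.exists_eq_argmaxCone [Finite J] {x : W} {F : Set W}
    (hF : IsFace F (argmaxCone κ ω x)) : ∃ y ∈ F, F = argmaxCone κ ω y := by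
  obtain ⟨u, hu, rfl⟩ := hF
  obtain ⟨y, hy, hsub⟩ := exists_subset_argmaxCone (κ := κ) (ω := ω) (x := x)
    (T := {z ∈ argmaxCone κ ω x | u z = 0}) (fun z hz => hz.1)
    ⟨0, zero_mem_argmaxCone x, map_zero u⟩
    (fun y hy z hz => ⟨by
      rw [mem_argmaxCone, argmaxSet_add hy.1 hz.1]
      exact Set.subset_inter hy.1 hz.1, by rw [map_add, hy.2, hz.2, add_zero]⟩)
  refine ⟨y, hy, hsub.antisymm fun z hz => ⟨argmaxCone_subset hy.1 hz, ?_⟩⟩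
  refine le_antisymm ?_ (hu z (argmaxCone_subset hy.1 hz))
  obtain ⟨t, ht, ht0⟩ := ((eventually_argmaxSet_subset (κ := κ) (ω := ω) y (-z)).filter_mono
    (nhdsWithin_le_nhds (s := Set.Ioi 0))).and self_mem_nhdsWithin |>.exists
  -- One can move from `y` slightly away from `z` without leaving the large cone; there `u` equals
  -- `-t * u z`, which forces `u z ≤ 0`.
  have hmem : y + t • -z ∈ argmaxCone κ ω x := by
    intro p hp
    obtain ⟨q, hq, hqp⟩ := exists_mem_argmaxSet κ ω (y + t • -z) p
    have h1 := argmaxSet_eq_of_mem (ht hq) (hy.1 hp) hqp.symm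
    have h2 := argmaxSet_eq_of_mem (hz (ht hq)) (hz (hy.1 hp)) hqp.symm
    exact mem_argmaxSet_of_eq hq hqp.symm (by simp [h1, h2])
  have h := hu _ hmem
  simp only [map_add, map_smul, map_neg, hy.2, smul_eq_mul, zero_add, mul_neg, neg_nonneg] at h
  exact nonpos_of_mul_nonpos_right h ht0

lemma exists_inter_eq_argmaxCone [Finite J] (κ : J → I) (ω : J → W →ₗ[ℝ] ℝ) (x y : W) :
    ∃ z, z ∈ argmaxCone κ ω x ∧ z ∈ argmaxCone κ ω y ∧
      argmaxCone κ ω x ∩ argmaxCone κ ω y = argmaxCone κ ω z := by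
  obtain ⟨z, hz, hsub⟩ := exists_subset_argmaxCone (κ := κ) (ω := ω) (x := x)
    (T := argmaxCone κ ω x ∩ argmaxCone κ ω y) Set.inter_subset_left
    ⟨0, zero_mem_argmaxCone x, zero_mem_argmaxCone y⟩
    (fun a ha b hb => ⟨by
      rw [mem_argmaxCone, argmaxSet_add ha.1 hb.1]; exact Set.subset_inter ha.1 hb.1, by
      rw [mem_argmaxCone, argmaxSet_add ha.2 hb.2]; exact Set.subset_inter ha.2 hb.2⟩)
  exact ⟨z, hz.1, hz.2, hsub.antisymm
    (Set.subset_inter (argmaxCone_subset hz.1) (argmaxCone_subset hz.2))⟩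

/-- The normal cones of a finite family form a polyhedral fan. -/
lemma isPolyhedralFan_range_argmaxCone [Finite J] (κ : J → I) (ω : J → W →ₗ[ℝ] ℝ) :
    IsPolyhedralFan (Set.range (argmaxCone κ ω)) where
  finite := by
    refine ((Set.toFinite (Set.univ : Set (Set J))).image
      fun S => {y | S ⊆ argmaxSet κ ω y}).subset ?_
    rintro _ ⟨x, rfl⟩
    exact ⟨argmaxSet κ ω x, trivial, rfl⟩
  nonempty := by rintro _ ⟨x, rfl⟩; exact ⟨x, mem_argmaxCone_self x⟩
  polyhedral := by rintro _ ⟨x, rfl⟩; exact isPolyhedralCone_argmaxCone x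
  face_mem := by
    rintro _ ⟨x, rfl⟩ F hF _
    obtain ⟨y, _, rfl⟩ := hF.exists_eq_argmaxCone
    exact ⟨y, rfl⟩
  inter_face := by
    rintro _ ⟨x, rfl⟩ _ ⟨y, rfl⟩
    obtain ⟨z, hx, hy, h⟩ := exists_inter_eq_argmaxCone κ ω x y
    rw [h]
    exact ⟨isFace_argmaxCone hx, isFace_argmaxCone hy⟩

lemma isComplete_range_argmaxCone (κ : J → I) (ω : J → W →ₗ[ℝ] ℝ) :
    IsComplete (Set.range (argmaxCone κ ω)) :=
  Set.eq_univ_of_forall fun x => ⟨_, ⟨x, rfl⟩, mem_argmaxCone_self x⟩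

-- From a relative interior point `y` the segment from `x` can be prolonged a little inside the
-- cone. A positive multiple of `y` is then a sum of a point of the cone and a positive multiple of
-- `x`, so `argmaxSet_add` applies.
open Filter Topology in
lemma argmaxSet_eq_of_mem_intrinsicInterior [Finite J] {x y : W}
    (h : y ∈ intrinsicInterior ℝ (argmaxCone κ ω x)) : argmaxSet κ ω y = argmaxSet κ ω x := by
  obtain ⟨y, hy, rfl⟩ := mem_intrinsicInterior.1 h
  refine Set.Subset.antisymm ?_ (intrinsicInterior_subset h)
  have hx : x ∈ affineSpan ℝ (argmaxCone κ ω x) :=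
    subset_affineSpan ℝ _ (mem_argmaxCone_self x)
  let f : ℝ → affineSpan ℝ (argmaxCone κ ω x) := fun t =>
    ⟨AffineMap.lineMap (y : W) x (-t), AffineMap.lineMap_mem _ y.2 hx⟩
  have hf : Continuous f := by
    refine Continuous.subtype_mk ?_ _
    simp only [AffineMap.lineMap_apply_module]
    fun_prop
  have hf0 : f 0 = y := by simp [f]
  have hev := (hf.tendsto 0).eventually
    (hf0 ▸ mem_interior_iff_mem_nhds.1 hy :
      ((↑) ⁻¹' argmaxCone κ ω x : Set (affineSpan ℝ (argmaxCone κ ω x))) ∈ 𝓝 (f 0))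
  obtain ⟨t, ht, ht0⟩ := (hev.filter_mono
    (nhdsWithin_le_nhds (s := Set.Ioi 0))).and self_mem_nhdsWithin |>.exists
  have ht0 : 0 < t := ht0
  have hz : AffineMap.lineMap (y : W) x (-t) ∈ argmaxCone κ ω x := ht
  have hx' : t • x ∈ argmaxCone κ ω x := by
    rw [mem_argmaxCone, argmaxSet_smul ht0]
  have heq : (1 + t) • (y : W) = AffineMap.lineMap (y : W) x (-t) + t • x := by
    rw [AffineMap.lineMap_apply_module]; module
  rw [← argmaxSet_smul (by positivity : 0 < 1 + t) (y : W), heq, argmaxSet_add hz hx',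
    argmaxSet_smul ht0]
  exact Set.inter_subset_right

lemma nonempty_intrinsicInterior_argmaxCone [FiniteDimensional ℝ W] (x : W) :
    (intrinsicInterior ℝ (argmaxCone κ ω x)).Nonempty :=
  Set.Nonempty.intrinsicInterior (convex_argmaxCone x) ⟨x, mem_argmaxCone_self x⟩

open Filter Topology in
/-- If the functionals of each class are distinct, then near every point there is one where each
class has a single maximal functional. -/
lemma exists_injOn_argmaxSet_subset [Finite J]
    (hω : ∀ p q, κ p = κ q → ω p = ω q → p = q) (x : W) :
    ∃ g, (argmaxSet κ ω g).InjOn κ ∧ argmaxSet κ ω g ⊆ argmaxSet κ ω x := by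
  -- A direction off the finitely many hyperplanes where two functionals of one class agree; a small
  -- step along it breaks all ties.
  obtain ⟨z, hz⟩ := Module.Dual.exists_forall_ne_zero_of_forall_exists (K := ℝ) (M := W)
    (ι := {a : J × J // κ a.1 = κ a.2 ∧ a.1 ≠ a.2}) (fun a => ω a.1.1 - ω a.1.2) (by
      rintro ⟨⟨p, q⟩, h, hne⟩
      by_contra! h0
      exact hne (hω p q h (LinearMap.ext fun v => sub_eq_zero.1 (h0 v))))
  obtain ⟨t, ht, ht0⟩ := ((eventually_argmaxSet_subset (κ := κ) (ω := ω) x z).filter_mono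
    (nhdsWithin_le_nhds (s := Set.Ioi 0))).and self_mem_nhdsWithin |>.exists
  have ht0 : 0 < t := ht0
  refine ⟨x + t • z, fun p hp q hq hpq => ?_, ht⟩
  by_contra hne
  have h1 := argmaxSet_eq_of_mem hq hp hpq
  have h2 := argmaxSet_eq_of_mem (ht hq) (ht hp) hpq
  simp only [map_add, map_smul, smul_eq_mul, h2, add_right_inj, mul_eq_mul_left_iff, ht0.ne',
    or_false] at h1
  exact hz ⟨(p, q), hpq, hne⟩ (sub_eq_zero.2 h1)

/-- Each class has a maximum at `y`, and the only candidate is the single one at `x`. -/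
lemma argmaxSet_eq_of_subset [Finite J] {x y : W} (hx : (argmaxSet κ ω x).InjOn κ)
    (h : argmaxSet κ ω y ⊆ argmaxSet κ ω x) : argmaxSet κ ω y = argmaxSet κ ω x := by
  refine h.antisymm fun p hp => ?_
  obtain ⟨q, hq, hqp⟩ := exists_mem_argmaxSet κ ω y p
  exact hx (h hq) hp hqp ▸ hq

/-- The open normal cone at `x`. -/
def openArgmaxCone (κ : J → I) (ω : J → W →ₗ[ℝ] ℝ) (x : W) : Set W :=
  {y | argmaxSet κ ω y = argmaxSet κ ω x}

lemma openArgmaxCone_eq [Finite J] {x : W} (hx : (argmaxSet κ ω x).InjOn κ) :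
    openArgmaxCone κ ω x = {y | ∀ u ∈ (fun a : J × J => ω a.1 - ω a.2) ''
      {a | a.1 ∈ argmaxSet κ ω x ∧ κ a.2 = κ a.1 ∧ a.2 ≠ a.1}, 0 < u y} := by
  ext y
  simp only [Set.mem_ofPred_eq, Set.forall_mem_image, Prod.forall, LinearMap.sub_apply, sub_pos,
    openArgmaxCone]
  constructor
  · rintro h p q ⟨hp, hqp, hne⟩
    rw [← h] at hp hx
    refine lt_of_le_of_ne (hp q hqp) fun he => hne (hx (mem_argmaxSet_of_eq hp hqp he) hp hqp)
  · refine fun h => argmaxSet_eq_of_subset hx fun q hq => ?_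
    obtain ⟨p, hp, hpq⟩ := exists_mem_argmaxSet κ ω x q
    by_cases hne : q = p
    · exact hne ▸ hp
    · exact absurd (h p q ⟨hp, hpq.symm, hne⟩) (hq p hpq).not_gt

lemma isOpenPolyhedralCone_openArgmaxCone [Finite J] {x : W}
    (hx : (argmaxSet κ ω x).InjOn κ) : IsOpenPolyhedralCone (openArgmaxCone κ ω x) :=
  ⟨_, Set.toFinite _, openArgmaxCone_eq hx⟩

lemma isOpen_openArgmaxCone [Finite J] [FiniteDimensional ℝ W] {x : W}
    (hx : (argmaxSet κ ω x).InjOn κ) : IsOpen (openArgmaxCone κ ω x) := by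
  obtain ⟨U, hU, h⟩ := isOpenPolyhedralCone_openArgmaxCone hx
  have : openArgmaxCone κ ω x = ⋂ u ∈ U, {y | 0 < u y} := by rw [h]; ext; simp
  rw [this]
  exact hU.isOpen_biInter fun u _ =>
    isOpen_lt continuous_const (LinearMap.continuous_of_finiteDimensional u)

lemma isFullDimensional_openArgmaxCone [Finite J] [FiniteDimensional ℝ W] {x : W}
    (hx : (argmaxSet κ ω x).InjOn κ) : IsFullDimensional (openArgmaxCone κ ω x) :=
  Submodule.eq_top_of_nonempty_interior' _
    ⟨x, interior_mono Submodule.subset_span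
      ((isOpen_openArgmaxCone hx).interior_eq.symm ▸ (rfl : argmaxSet κ ω x = _))⟩

lemma isClosed_argmaxCone [FiniteDimensional ℝ W] (x : W) : IsClosed (argmaxCone κ ω x) := by
  have : argmaxCone κ ω x = ⋂ p ∈ argmaxSet κ ω x, ⋂ q, ⋂ (_ : κ q = κ p),
      {y | ω q y ≤ ω p y} := by
    ext y
    simp only [Set.mem_iInter]
    rfl
  rw [this]
  exact isClosed_biInter fun p _ => isClosed_iInter fun q => isClosed_iInter fun _ =>
    isClosed_le (LinearMap.continuous_of_finiteDimensional _)
      (LinearMap.continuous_of_finiteDimensional _)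

open Filter Topology in
lemma closure_openArgmaxCone [Finite J] [FiniteDimensional ℝ W] (x : W) :
    closure (openArgmaxCone κ ω x) = argmaxCone κ ω x := by
  refine (closure_minimal (fun y hy => ?_) (isClosed_argmaxCone x)).antisymm fun y hy => ?_
  · exact (hy : argmaxSet κ ω y = _).symm.subset
  -- Any `y` in the closed cone is the limit of `y + t • x` as `t` decreases to `0`, and these
  -- points have the maximal set of `x`.
  · have hc : Continuous fun t : ℝ => y + t • x := by fun_prop
    have ht : Tendsto (fun t : ℝ => y + t • x) (𝓝[>] 0) (𝓝 y) := by
      simpa using (hc.tendsto 0).mono_left nhdsWithin_le_nhds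
    refine mem_closure_of_tendsto ht ?_
    filter_upwards [self_mem_nhdsWithin] with t ht
    have ht : 0 < t := ht
    have hx : t • x ∈ argmaxCone κ ω x := by rw [mem_argmaxCone, argmaxSet_smul ht]
    change argmaxSet κ ω _ = _
    rw [argmaxSet_add hy hx, argmaxSet_smul ht]
    exact Set.inter_eq_right.2 hy

/-- The maximal normal cones are those at points where each class has a single maximum. -/
lemma maximal_mem_range_argmaxCone_iff [Finite J]
    (hω : ∀ p q, κ p = κ q → ω p = ω q → p = q) {F : Set W} :
    Maximal (· ∈ Set.range (argmaxCone κ ω)) F ↔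
      ∃ g, (argmaxSet κ ω g).InjOn κ ∧ F = argmaxCone κ ω g := by
  constructor
  · rintro ⟨⟨x, rfl⟩, hmax⟩
    obtain ⟨g, hg, hgx⟩ := exists_injOn_argmaxSet_subset hω x
    have h : argmaxCone κ ω x ⊆ argmaxCone κ ω g := argmaxCone_subset hgx
    exact ⟨g, hg, h.antisymm (hmax ⟨g, rfl⟩ h)⟩
  · rintro ⟨g, hg, rfl⟩
    refine ⟨⟨g, rfl⟩, ?_⟩
    rintro _ ⟨y, rfl⟩ h
    have := argmaxSet_eq_of_subset hg (h (mem_argmaxCone_self g))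
    simp only [argmaxCone, this, le_refl]

/-- The normal fan consists of the faces of its maximal cones. -/
lemma range_argmaxCone_eq [Finite J] (hω : ∀ p q, κ p = κ q → ω p = ω q → p = q) :
    Set.range (argmaxCone κ ω) =
      {F | ∃ g, (argmaxSet κ ω g).InjOn κ ∧ IsFace F (argmaxCone κ ω g)} := by
  ext F
  constructor
  · rintro ⟨x, rfl⟩
    obtain ⟨g, hg, hgx⟩ := exists_injOn_argmaxSet_subset hω x
    exact ⟨g, hg, isFace_argmaxCone hgx⟩
  · rintro ⟨g, _, hF⟩
    obtain ⟨y, _, rfl⟩ := hF.exists_eq_argmaxCone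
    exact ⟨y, rfl⟩

end ArgmaxFan

end Maxoid

namespace Maxoid

/-! ### Directed paths, critical paths and maxoids -/

section Graphs

open Relation

variable {V : Type*} {G : Digraph V}

lemma IsDAG.not_reflTransGen (hG : IsDAG G) {u v : V} (h : G.Adj u v) :
    ¬ ReflTransGen G.Adj v u := fun h' => hG u (TransGen.head' h h')

lemma IsDAG.eq_of_reflTransGen (hG : IsDAG G) {u v : V} (h : ReflTransGen G.Adj u v)
    (h' : ReflTransGen G.Adj v u) : u = v := by
  rcases ReflTransGen.cases_head h with rfl | ⟨w, hw, hwv⟩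
  · rfl
  · exact absurd (hwv.trans h') (hG.not_reflTransGen hw)

namespace DiPath

lemma reflTransGen {i j : V} (p : DiPath G i j) : ReflTransGen G.Adj i j := by
  induction p with
  | nil => exact .refl
  | cons h _ ih => exact .head h ih

lemma reflTransGen_of_mem_nodes {i j x : V} (p : DiPath G i j) (hx : x ∈ p.nodes) :
    ReflTransGen G.Adj i x ∧ ReflTransGen G.Adj x j := by
  induction p with
  | nil => exact (Set.mem_singleton_iff.1 hx) ▸ ⟨.refl, .refl⟩
  | cons h p ih =>
    rcases hx with rfl | hx
    · exact ⟨.refl, .head h p.reflTransGen⟩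
    · exact ⟨.head h (ih hx).1, (ih hx).2⟩

lemma left_mem_nodes {i j : V} (p : DiPath G i j) : i ∈ p.nodes := by
  cases p with
  | nil => exact rfl
  | cons => exact Set.mem_insert _ _

/-- The weight of a path as a linear functional of the weight matrix. -/
def weightHom {i j : V} (p : DiPath G i j) : Weight G →ₗ[ℝ] ℝ where
  toFun C := p.weight C
  map_add' C D := by
    induction p with
    | nil => simp [weight]
    | cons h p ih => simp only [weight, ih, Pi.add_apply]; ring
  map_smul' t C := by
    induction p with
    | nil => simp [weight]
    | cons h p ih => simp only [weight, ih, Pi.smul_apply, smul_eq_mul, RingHom.id_apply]; ring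

@[simp]
lemma weightHom_apply {i j : V} (p : DiPath G i j) (C : Weight G) : p.weightHom C = p.weight C :=
  rfl

open Classical in
lemma weight_single_eq_zero {u v i j : V} (h : G.Adj u v) (p : DiPath G i j)
    (hi : ¬ ReflTransGen G.Adj i u) : p.weight (Pi.single ⟨(u, v), h⟩ 1) = 0 := by
  induction p with
  | nil => rfl
  | @cons a b c h' p ih =>
    have hne : (⟨(a, b), h'⟩ : Edge G) ≠ ⟨(u, v), h⟩ := by
      intro he
      simp only [Subtype.mk.injEq, Prod.mk.injEq] at he
      exact hi (he.1 ▸ .refl)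
    rw [weight, Pi.single_eq_of_ne hne, ih fun h0 => hi (.head h' h0), add_zero]

open Classical in
/-- In a DAG, parallel paths with the same weight functional are equal. -/
lemma eq_of_weightHom_eq (hG : IsDAG G) {i j : V} (p q : DiPath G i j)
    (h : p.weightHom = q.weightHom) : p = q := by
  induction p with
  | nil v =>
    cases q with
    | nil => rfl
    | cons h' q => exact absurd q.reflTransGen (hG.not_reflTransGen h')
  | @cons u v w hv p ih =>
    cases q with
    | nil => exact absurd p.reflTransGen (hG.not_reflTransGen hv)
    | @cons _ v' _ hv' q =>
      -- The unit weight on the first edge of the left path detects whether the other path starts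
      -- with it: by acyclicity neither tail can return to `u`.
      have h1 := LinearMap.congr_fun h (Pi.single ⟨(u, v), hv⟩ 1)
      simp only [weightHom_apply, weight, Pi.single_eq_same,
        weight_single_eq_zero hv _ (hG.not_reflTransGen hv),
        weight_single_eq_zero hv _ (hG.not_reflTransGen hv'), add_zero] at h1
      have hvv : v = v' := by
        by_contra hne
        rw [Pi.single_eq_of_ne] at h1
        · exact one_ne_zero h1
        · exact fun he => hne (congrArg (fun e : Edge G => e.1.2) he).symm
      subst hvv
      rw [ih q (LinearMap.ext fun C => by simpa [weight] using LinearMap.congr_fun h C)]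

/-- Induction on the start node, descendants first: a path is empty or an edge followed by a path
from a child. -/
lemma finite [Finite V] (hG : IsDAG G) (i j : V) : Finite (DiPath G i j) := by
  have : IsTrans V (flip (TransGen G.Adj)) := ⟨fun _ _ _ h h' => h'.trans h⟩
  have : Std.Irrefl (flip (TransGen G.Adj)) := ⟨hG⟩
  induction i using (Finite.wellFounded_of_trans_of_irrefl (flip (TransGen G.Adj))).induction with
  | _ u ih =>
    have (v : {v // G.Adj u v}) : Finite (DiPath G v j) := ih v (.single v.2)
    let f : (Σ v : {v // G.Adj u v}, DiPath G v j) → DiPath G u j := fun a => .cons a.1.2 a.2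
    let g : PLift (u = j) → DiPath G u j := fun h => h.down ▸ DiPath.nil u
    refine Set.finite_univ_iff.1
      (((Set.finite_range f).union (Set.finite_range g)).subset fun p _ => ?_)
    cases p with
    | nil => exact Or.inr ⟨⟨rfl⟩, rfl⟩
    | @cons _ v _ h p => exact Or.inl ⟨⟨⟨v, h⟩, p⟩, rfl⟩

end DiPath

lemma IsCritical.tail {C : Weight G} {u v w : V} {h : G.Adj u v} {p : DiPath G v w}
    (hp : IsCritical C (.cons h p)) : IsCritical C p := fun q => by
  simpa [DiPath.weight] using hp (.cons h q)

lemma CritAdj.reflTransGen {C : Weight G} {L : Set V} {i j : V} (h : CritAdj G C L i j) :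
    ReflTransGen G.Adj i j := h.2.1.some.reflTransGen

/-- `C*`-connectedness is monotone in the critical DAG. -/
lemma CStarConnected.mono {C D : Weight G} {L : Set V}
    (h : ∀ i j, CritAdj G C L i j → CritAdj G D L i j) {i j : V}
    (hij : CStarConnected G C L i j) : CStarConnected G D L i j := by
  rcases hij with (h1 | h1) | ⟨p, hp, h1, h2⟩ | ⟨l, hl, h1, h2⟩ | ⟨p, l, hp, hl, hne, h1, h2, h3⟩ |
    ⟨p, l, hp, hl, hne, h1, h2, h3⟩ | ⟨p, l, q, hp, hl, hq, n1, n2, n3, h1, h2, h3, h4⟩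
  · exact .inl (.inl (h _ _ h1))
  · exact .inl (.inr (h _ _ h1))
  · exact .inr (.inl ⟨p, hp, h _ _ h1, h _ _ h2⟩)
  · exact .inr (.inr (.inl ⟨l, hl, h _ _ h1, h _ _ h2⟩))
  · exact .inr (.inr (.inr (.inl ⟨p, l, hp, hl, hne, h _ _ h1, h _ _ h2, h _ _ h3⟩)))
  · exact .inr (.inr (.inr (.inr (.inl ⟨p, l, hp, hl, hne, h _ _ h1, h _ _ h2, h _ _ h3⟩))))
  · exact .inr (.inr (.inr (.inr (.inr ⟨p, l, q, hp, hl, hq, n1, n2, n3,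
      h _ _ h1, h _ _ h2, h _ _ h3, h _ _ h4⟩))))

/-- The ancestors of `j` other than `i` that, if they are descendants of `i`, are ancestors
of `a`. -/
def separator (G : Digraph V) (i j a : V) : Set V :=
  {x | ReflTransGen G.Adj x j ∧ x ≠ j ∧ x ≠ i ∧
    (ReflTransGen G.Adj i x → ReflTransGen G.Adj x a)}

/-- Given `separator G i j a`, the nodes `i` and `j` can only be connected by an edge. -/
lemma critAdj_of_cStarConnected_separator (hG : IsDAG G) {C : Weight G} {i j a : V}
    (hij : ReflTransGen G.Adj i j) (hne : i ≠ j)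
    (h : CStarConnected G C (separator G i j a) i j) : CritAdj G C (separator G i j a) i j := by
  have fork {p : V} (hp : p ∉ separator G i j a) : ¬ CritAdj G C (separator G i j a) p i := by
    intro h1
    refine hp ⟨h1.reflTransGen.trans hij, ?_, h1.1, fun h2 => ?_⟩
    · exact fun h2 => hne (hG.eq_of_reflTransGen hij (h2 ▸ h1.reflTransGen))
    · exact absurd (hG.eq_of_reflTransGen h1.reflTransGen h2) h1.1
  have collider {l : V} (hl : l ∈ separator G i j a) : ¬ CritAdj G C (separator G i j a) j l :=
    fun h1 => hl.2.1 (hG.eq_of_reflTransGen hl.1 h1.reflTransGen)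
  rcases h with (h1 | h1) | ⟨p, hp, h1, h2⟩ | ⟨l, hl, h1, h2⟩ | ⟨p, l, hp, hl, n1, h1, h2, h3⟩ |
    ⟨p, l, hp, hl, n1, h1, h2, h3⟩ | ⟨p, l, q, hp, hl, hq, n1, n2, n3, h1, h2, h3, h4⟩
  · exact h1
  · exact absurd (hG.eq_of_reflTransGen hij h1.reflTransGen) hne
  · exact absurd h1 (fork hp)
  · exact absurd h2 (collider hl)
  · exact absurd h1 (fork hp)
  -- Type `i → l ← p → j`: if `p` descends from `i`, it reaches `a` through `l`, so `p` would lie in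
  -- the separator.
  · refine absurd ⟨h3.reflTransGen, h3.1, n1, fun h4 => ?_⟩ hp
    exact h2.reflTransGen.trans (hl.2.2.2 (h4.trans h2.reflTransGen))
  · exact absurd h1 (fork hp)

/-- Condition on `separator G i j v`. If `v ≠ j`, it contains `v`, which blocks the edge `i → j` for
`C`; the resulting independence also holds for `D`. Hence the unique `D`-critical path has an
interior node in the separator. This node descends from `w` and is an ancestor of `v`. -/
lemma reflTransGen_of_maxoid_subset (hG : IsDAG G) {C D : Weight G} (hD : IsGeneric G D)
    (h : maxoid G C ⊆ maxoid G D) {i j v w : V} {hv : G.Adj i v} {hw : G.Adj i w}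
    {p : DiPath G v j} {q : DiPath G w j} (hp : IsCritical C (.cons hv p))
    (hq : IsCritical D (.cons hw q)) : ReflTransGen G.Adj w v := by
  by_cases hvj : v = j
  · exact hvj ▸ q.reflTransGen
  have hij : ReflTransGen G.Adj i j := .head hv p.reflTransGen
  have hne : i ≠ j := by rintro rfl; exact hG.not_reflTransGen hv p.reflTransGen
  have hvi : v ≠ i := by rintro rfl; exact hG.not_reflTransGen hv .refl
  let s : CIStatement V :=
    { left := {i}
      right := {j}
      given := separator G i j v
      left_right := Set.disjoint_singleton.2 hne
      left_given := Set.disjoint_singleton_left.2 fun h => h.2.2.1 rfl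
      right_given := Set.disjoint_singleton_left.2 fun h => h.2.1 rfl }
  have hs : s ∈ maxoid G C := by
    intro i' hi' j' hj' hc
    rw [show i' = i from hi', show j' = j from hj'] at hc
    have hc := critAdj_of_cStarConnected_separator hG hij hne hc
    exact hc.2.2 _ hp v (Set.mem_insert_of_mem _ p.left_mem_nodes) hvi hvj
      ⟨p.reflTransGen, hvj, hvi, fun _ => .refl⟩
  have hc : ¬ CritAdj G D (separator G i j v) i j := fun hc => h hs i rfl j rfl (.inl (.inl hc))
  simp only [CritAdj, not_and, not_forall, not_not] at hc
  obtain ⟨q', hq', k, hk, hki, hkj, hkL⟩ := hc hne ⟨.cons hv p⟩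
  rw [(hD i j ⟨q'⟩).unique hq' hq] at hk
  have hk := q.reflTransGen_of_mem_nodes (hk.resolve_left hki)
  exact hk.1.trans (hkL.2.2.2 (.head hw hk.1))

/-- Generic weight matrices with the same maxoid have the same critical paths. -/
lemma IsCritical.eq_of_maxoid_eq (hG : IsDAG G) {C D : Weight G} (hC : IsGeneric G C)
    (hD : IsGeneric G D) (h : maxoid G C = maxoid G D) {i j : V} {p q : DiPath G i j}
    (hp : IsCritical C p) (hq : IsCritical D q) : p = q := by
  induction p with
  | nil v =>
    cases q with
    | nil => rfl
    | cons h' q => exact absurd q.reflTransGen (hG.not_reflTransGen h')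
  | @cons u v w hv p ih =>
    cases q with
    | nil => exact absurd p.reflTransGen (hG.not_reflTransGen hv)
    | @cons _ v' _ hv' q =>
      obtain rfl := hG.eq_of_reflTransGen
        (reflTransGen_of_maxoid_subset hG hC h.symm.subset hq hp)
        (reflTransGen_of_maxoid_subset hG hD h.subset hp hq)
      rw [ih hp.tail hq.tail]

/-! ### The maxoid fan as the normal fan of the path functionals -/

/-- The directed paths of a digraph, sorted by their ends. -/
abbrev AnyPath (G : Digraph V) : Type _ := Σ e : V × V, DiPath G e.1 e.2

/-- The ends of a path. -/
abbrev AnyPath.ends (p : AnyPath G) : V × V := p.1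

/-- The weight functional of a path. -/
abbrev AnyPath.weightHom (p : AnyPath G) : Weight G →ₗ[ℝ] ℝ := p.2.weightHom

/-- The set of critical paths of a weight matrix. -/
abbrev criticalSet [Fintype (Edge G)] (C : Weight G) : Set (AnyPath G) :=
  argmaxSet AnyPath.ends AnyPath.weightHom C

lemma AnyPath.finite [Finite V] (hG : IsDAG G) : Finite (AnyPath G) :=
  have (e : V × V) := DiPath.finite hG e.1 e.2
  inferInstance

lemma AnyPath.eq_of_weightHom_eq (hG : IsDAG G) (p q : AnyPath G) (h : p.ends = q.ends)
    (hw : p.weightHom = q.weightHom) : p = q := by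
  obtain ⟨e, p⟩ := p
  obtain ⟨e', q⟩ := q
  obtain rfl : e = e' := h
  rw [DiPath.eq_of_weightHom_eq hG p q hw]

section

variable [Fintype (Edge G)]

lemma mem_criticalSet {C : Weight G} {i j : V} {p : DiPath G i j} :
    (⟨(i, j), p⟩ : AnyPath G) ∈ criticalSet C ↔ IsCritical C p := by
  constructor
  · exact fun h q => h ⟨(i, j), q⟩ rfl
  · rintro h ⟨e, q⟩ he
    obtain rfl : e = (i, j) := he
    exact h q

lemma maxoid_subset_of_criticalSet_subset {C D : Weight G} (h : criticalSet C ⊆ criticalSet D) :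
    maxoid G C ⊆ maxoid G D := fun _ hs i hi j hj hc =>
  hs i hi j hj <| hc.mono fun _ _ h' =>
    ⟨h'.1, h'.2.1, fun p hp => h'.2.2 p (mem_criticalSet.1 (h (mem_criticalSet.2 hp)))⟩

lemma isGeneric_iff_injOn [Finite (AnyPath G)] {C : Weight G} :
    IsGeneric G C ↔ (criticalSet C).InjOn AnyPath.ends := by
  constructor
  · rintro h ⟨⟨i, j⟩, p⟩ hp ⟨e, q⟩ hq he
    obtain rfl : (i, j) = e := he
    rw [(h i j ⟨p⟩).unique (mem_criticalSet.1 hp) (mem_criticalSet.1 hq)]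
  · rintro h i j ⟨p⟩
    obtain ⟨⟨e, q⟩, hq, he⟩ := exists_mem_argmaxSet AnyPath.ends AnyPath.weightHom C ⟨(i, j), p⟩
    obtain rfl : e = (i, j) := he
    refine ⟨q, mem_criticalSet.1 hq, fun r hr => ?_⟩
    simpa using h (mem_criticalSet.2 hr) hq rfl

lemma maxoid_eq_iff_criticalSet_eq (hG : IsDAG G) {C D : Weight G} (hC : IsGeneric G C)
    (hD : IsGeneric G D) : maxoid G C = maxoid G D ↔ criticalSet C = criticalSet D := by
  constructor
  · intro h
    ext ⟨⟨i, j⟩, p⟩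
    simp only [mem_criticalSet]
    constructor <;> intro hp
    · obtain ⟨q, hq, -⟩ := hD i j ⟨p⟩
      exact hp.eq_of_maxoid_eq hG hC hD h hq ▸ hq
    · obtain ⟨q, hq, -⟩ := hC i j ⟨p⟩
      exact hp.eq_of_maxoid_eq hG hD hC h.symm hq ▸ hq
  · exact fun h => (maxoid_subset_of_criticalSet_subset h.subset).antisymm
      (maxoid_subset_of_criticalSet_subset h.symm.subset)

lemma openCone_maxoid_eq [Finite (AnyPath G)] (hG : IsDAG G) {C : Weight G}
    (hC : IsGeneric G C) :
    openCone G (maxoid G C) = openArgmaxCone AnyPath.ends AnyPath.weightHom C := by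
  ext D
  constructor
  · rintro ⟨hD, h⟩
    exact (maxoid_eq_iff_criticalSet_eq hG hD hC).1 h
  · intro h
    have hD : IsGeneric G D := by
      rw [isGeneric_iff_injOn, criticalSet, show argmaxSet _ _ D = _ from h]
      exact isGeneric_iff_injOn.1 hC
    exact ⟨hD, (maxoid_eq_iff_criticalSet_eq hG hD hC).2 h⟩

lemma closure_openCone_maxoid_eq [Finite (AnyPath G)] (hG : IsDAG G) {C : Weight G}
    (hC : IsGeneric G C) :
    closure (openCone G (maxoid G C)) = argmaxCone AnyPath.ends AnyPath.weightHom C := by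
  rw [openCone_maxoid_eq hG hC]
  exact closure_openArgmaxCone C

lemma maxoidFan_eq [Finite (AnyPath G)] (hG : IsDAG G) :
    maxoidFan G = Set.range (argmaxCone (J := AnyPath G) AnyPath.ends AnyPath.weightHom) := by
  rw [range_argmaxCone_eq (AnyPath.eq_of_weightHom_eq hG)]
  ext F
  constructor
  · rintro ⟨_, ⟨C, hC, rfl⟩, hF⟩
    exact ⟨C, isGeneric_iff_injOn.1 hC, closure_openCone_maxoid_eq hG hC ▸ hF⟩
  · rintro ⟨C, hC, hF⟩
    have hC := isGeneric_iff_injOn.2 hC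
    exact ⟨_, ⟨C, hC, rfl⟩, (closure_openCone_maxoid_eq hG hC).symm ▸ hF⟩

lemma maxoid_eq_of_mem_intrinsicInterior [Finite (AnyPath G)] {C D : Weight G}
    (h : D ∈ intrinsicInterior ℝ (argmaxCone (J := AnyPath G) AnyPath.ends AnyPath.weightHom C)) :
    maxoid G D = maxoid G C := by
  have h := argmaxSet_eq_of_mem_intrinsicInterior h
  exact (maxoid_subset_of_criticalSet_subset h.subset).antisymm
    (maxoid_subset_of_criticalSet_subset h.symm.subset)

/-- The union defining `coneMaxoid` runs over a nonempty set on which the maxoid is constant. -/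
lemma coneMaxoid_argmaxCone [Finite (AnyPath G)] (C : Weight G) :
    coneMaxoid G (argmaxCone (J := AnyPath G) AnyPath.ends AnyPath.weightHom C) = maxoid G C := by
  ext s
  constructor
  · rintro ⟨D, hD, hs⟩
    exact maxoid_eq_of_mem_intrinsicInterior hD ▸ hs
  · intro hs
    obtain ⟨D, hD⟩ := nonempty_intrinsicInterior_argmaxCone (κ := AnyPath.ends (G := G))
      (ω := AnyPath.weightHom) C
    exact ⟨D, hD, (maxoid_eq_of_mem_intrinsicInterior hD).symm ▸ hs⟩

end

end Graphs

end Maxoid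


open Maxoid in
theorem mainTheorem1 {V : Type*} [Finite V] (G : Digraph V) (hG : Maxoid.IsDAG G) :
    -- the non-generic matrices lie in a finite union of linear hyperplanes
    (∃ A : Set (Maxoid.Weight G →ₗ[ℝ] ℝ), A.Finite ∧ (∀ u ∈ A, u ≠ 0) ∧
      ∀ C : Maxoid.Weight G, ¬ Maxoid.IsGeneric G C → ∃ u ∈ A, u C = 0) ∧
    -- every generic maxoid is realized by a full-dimensional open polyhedral cone
    (∀ M ∈ Maxoid.genericMaxoids G, Maxoid.IsOpenPolyhedralCone (Maxoid.openCone G M) ∧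
      Maxoid.IsFullDimensional (Maxoid.openCone G M)) ∧
    -- the closures of these cones, with their faces, form a complete polyhedral fan
    Maxoid.IsPolyhedralFan (Maxoid.maxoidFan G) ∧
    Maxoid.IsComplete (Maxoid.maxoidFan G) ∧
    -- its maximal cones are in bijection with the generic maxoids
    Set.BijOn (fun M => closure (Maxoid.openCone G M))
      (Maxoid.genericMaxoids G) (Maxoid.maximalCones G) ∧
    (∀ M ∈ Maxoid.genericMaxoids G,
      Maxoid.coneMaxoid G (closure (Maxoid.openCone G M)) = M) ∧
    -- the map `Φ` is well defined: the maxoid is constant on the relative interior of each cone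
    (∀ F ∈ Maxoid.maxoidFan G, (intrinsicInterior ℝ F).Nonempty ∧
      ∀ C ∈ intrinsicInterior ℝ F, Maxoid.maxoid G C = Maxoid.coneMaxoid G F) ∧
    -- `Φ` maps the fan onto the set of all maxoids of `G`
    Maxoid.coneMaxoid G '' Maxoid.maxoidFan G = Set.range (Maxoid.maxoid G) ∧
    -- `Φ` reverses inclusions
    (∀ F₁ ∈ Maxoid.maxoidFan G, ∀ F₂ ∈ Maxoid.maxoidFan G, Maxoid.IsFace F₁ F₂ →
      Maxoid.coneMaxoid G F₂ ⊆ Maxoid.coneMaxoid G F₁) := by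
  -- This instance supplies the norm on `Weight G`.
  have := Fintype.ofFinite (Edge G)
  have := AnyPath.finite hG
  have hω := AnyPath.eq_of_weightHom_eq hG
  refine ⟨?_, ?_, ?_, ?_, ?_, ?_, ?_, ?_, ?_⟩
  · refine ⟨(fun a : AnyPath G × AnyPath G => a.1.weightHom - a.2.weightHom) ''
      {a | a.1.ends = a.2.ends ∧ a.1 ≠ a.2}, Set.toFinite _, ?_, fun C hC => ?_⟩
    · rintro _ ⟨⟨p, q⟩, ⟨h, hne⟩, rfl⟩ h0
      exact hne (hω p q h (sub_eq_zero.1 h0))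
    · simp only [isGeneric_iff_injOn, Set.InjOn, not_forall] at hC
      obtain ⟨p, hp, q, hq, h, hne⟩ := hC
      exact ⟨_, ⟨(p, q), ⟨h, hne⟩, rfl⟩, sub_eq_zero.2 (argmaxSet_eq_of_mem hq hp h)⟩
  · rintro _ ⟨C, hC, rfl⟩
    rw [openCone_maxoid_eq hG hC]
    have hC := isGeneric_iff_injOn.1 hC
    exact ⟨isOpenPolyhedralCone_openArgmaxCone hC, isFullDimensional_openArgmaxCone hC⟩
  · rw [maxoidFan_eq hG]
    exact isPolyhedralFan_range_argmaxCone _ _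
  · rw [maxoidFan_eq hG]
    exact isComplete_range_argmaxCone _ _
  · refine ⟨?_, ?_, ?_⟩
    · rintro _ ⟨C, hC, rfl⟩
      simp only [maximalCones, maxoidFan_eq hG]
      exact (maximal_mem_range_argmaxCone_iff hω).2
        ⟨C, isGeneric_iff_injOn.1 hC, closure_openCone_maxoid_eq hG hC⟩
    · rintro _ ⟨C, hC, rfl⟩ _ ⟨D, hD, rfl⟩ h
      simp only [closure_openCone_maxoid_eq hG hC, closure_openCone_maxoid_eq hG hD] at h
      -- Injectivity holds because `Φ` recovers the maxoid from the closed cone.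
      rw [← coneMaxoid_argmaxCone C, h, coneMaxoid_argmaxCone]
    · intro F hF
      simp only [maximalCones, maxoidFan_eq hG] at hF
      obtain ⟨C, hC, rfl⟩ := (maximal_mem_range_argmaxCone_iff hω).1 hF
      have hC := isGeneric_iff_injOn.2 hC
      exact ⟨_, ⟨C, hC, rfl⟩, closure_openCone_maxoid_eq hG hC⟩
  · rintro _ ⟨C, hC, rfl⟩
    rw [closure_openCone_maxoid_eq hG hC, coneMaxoid_argmaxCone]
  · rw [maxoidFan_eq hG]
    rintro _ ⟨C, rfl⟩
    refine ⟨nonempty_intrinsicInterior_argmaxCone C, fun D hD => ?_⟩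
    rw [coneMaxoid_argmaxCone, maxoid_eq_of_mem_intrinsicInterior hD]
  · rw [maxoidFan_eq hG, ← Set.range_comp]
    exact congrArg Set.range (funext coneMaxoid_argmaxCone)
  · rw [maxoidFan_eq hG]
    rintro _ ⟨C, rfl⟩ _ ⟨D, rfl⟩ ⟨u, -, h⟩
    -- A face lies in its cone, and membership of `C` in the cone of `D` is containment of critical
    -- sets.
    have hCD : C ∈ argmaxCone (J := AnyPath G) AnyPath.ends AnyPath.weightHom D :=
      ((Set.ext_iff.1 h C).1 (mem_argmaxCone_self C)).1
    rw [coneMaxoid_argmaxCone, coneMaxoid_argmaxCone]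
    exact maxoid_subset_of_criticalSet_subset hCD
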